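/- Let $\mathbf p=(p_i:i\ge1)$ be a ranked probability distribution on the positive integers, that is, $p_1\ge p_2\ge\cdots\ge0$ and $\sum_{i\ge1}p_i=1$, and let $\sigma_{\mathbf p}:=\bigl(\sum_{i\ge1}p_i^2\bigr)^{1/2}$. Let $\mathcal T_{\mathbf p}$ be a $\mathbf p$-tree, i.e. a random graph with vertex set $\{i\ge1:p_i>0\}$ distributed as the birthday tree whose undirected edges are the pairs $\{Y_{j-1},Y_j\}$, $j\ge1$, with $Y_j\notin\{Y_0,\dots,Y_{j-1}\}$, where $Y_0,Y_1,\dots$ are i.i.d. with distribution $\mathbf p$. Let $V_1,V_2$ be two independent random vertices of $\mathcal T_{\mathbf p}$, each with distribution $\mathbf p$, such that the pair $(V_1,V_2)$ is independent of $\mathcal T_{\mathbf p}$, and let $d$ denote the graph distance in $\mathcal T_{\mathbf p}$. Then, for all real $x\ge8$, $$\mathbb P\bigl(d(V_1,V_2)\ge x\,\sigma_{\mathbf p}^{-1}\bigr)\le \exp\Bigl(-\frac{x^{1/3}}{3\sigma_{\mathbf p}}\Bigr)+6\exp\Bigl(-\frac{x^{2/3}}{6}\Bigr).$$ -/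

import Mathlib

open MeasureTheory ProbabilityTheory

instance PNat.instMeasurableSpaceTop : MeasurableSpace ℕ+ := ⊤

instance PNat.instDiscreteMeasurableSpaceTop : DiscreteMeasurableSpace ℕ+ := ⟨fun _ => trivial⟩

/-- The parameter `σ_p = (∑ i, p_i ^ 2) ^ (1/2)`. The series converges, since
`0 ≤ p_i ≤ 1` and `∑ i, p_i = 1`. -/
noncomputable def sigmaP (p : PMF ℕ+) : ℝ :=
  Real.sqrt (∑' i : ℕ+, (p i).toReal ^ 2)

/-- The graph with vertex set `S` whose edges are the pairs `{y (j - 1), y j}` with `j ≥ 1` and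
`y j ∉ {y 0, …, y (j - 1)}` (below, `j + 1` stands for `j`). -/
def birthdayTree (S : Set ℕ+) (y : ℕ → ℕ+) : SimpleGraph S :=
  SimpleGraph.fromRel fun u v : S =>
    ∃ j : ℕ, y j = u ∧ y (j + 1) = v ∧ ∀ i ≤ j, y (j + 1) ≠ y i

theorem measurable_birthdayTree (S : Set ℕ+) : Measurable (birthdayTree S) := by
  refine measurable_comap_iff.2 (measurable_pi_iff.2 fun u => measurable_pi_iff.2 fun v => ?_)
  have key : ∀ a b : S, MeasurableSet {y : ℕ → ℕ+ | ∃ j : ℕ, y j = a ∧ y (j + 1) = b ∧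
      ∀ i ≤ j, y (j + 1) ≠ y i} := by
    intro a b
    have ev : ∀ (j : ℕ) (c : ℕ+), MeasurableSet {y : ℕ → ℕ+ | y j = c} := fun j c =>
      (measurable_pi_apply j : Measurable fun y : ℕ → ℕ+ => y j)
        (MeasurableSet.of_discrete (s := ({c} : Set ℕ+)))
    have ne : ∀ j i : ℕ, MeasurableSet {y : ℕ → ℕ+ | y j ≠ y i} := fun j i =>
      (measurableSet_eq_fun (measurable_pi_apply j) (measurable_pi_apply i)).compl
    simp only [Set.setOf_exists, Set.setOf_and, Set.setOf_forall]
    exact MeasurableSet.iUnion fun j => (ev j a).inter ((ev (j + 1) b).inter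
      (MeasurableSet.iInter fun i => MeasurableSet.iInter fun _ => ne (j + 1) i))
  refine measurable_to_prop ?_
  have : (fun y : ℕ → ℕ+ => ((SimpleGraph.Adj ∘ birthdayTree S) y u v)) ⁻¹' {True} =
      {_y | u ≠ v} ∩ ({y | ∃ j : ℕ, y j = (u : ℕ+) ∧ y (j + 1) = (v : ℕ+) ∧
          ∀ i ≤ j, y (j + 1) ≠ y i} ∪
        {y | ∃ j : ℕ, y j = (v : ℕ+) ∧ y (j + 1) = (u : ℕ+) ∧ ∀ i ≤ j, y (j + 1) ≠ y i}) := by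
    ext y
    simp only [birthdayTree, Function.comp_apply, SimpleGraph.fromRel_adj, Set.mem_preimage,
      Set.mem_singleton_iff, eq_iff_iff, iff_true, Set.mem_inter_iff, Set.mem_union,
      Set.mem_ofPred_eq]
  rw [this]
  exact (MeasurableSet.const _).inter ((key u v).union (key v u))

/-- The law of the `p`-tree: its vertex set is the support of `p`, and it is the birthday tree of a
sequence `Y_0, Y_1, …` of independent random variables with the distribution `p`. -/
noncomputable def pTreeLaw (p : PMF ℕ+) : Measure (SimpleGraph p.support) :=
  (Measure.infinitePi fun _ : ℕ => p.toMeasure).map (birthdayTree p.support)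

/-! Go from both vertices to the root `Y₀`: a distance of at least `r` forces one of them to have
about `r / 2` ancestors. The chance that a prescribed line of distinct vertices is a line of descent
is at most the product of the weights of all but its last vertex (`iidLaw_isChain_le`); this comes
from following the line as the sequence unfolds, with an explicit supermartingale
(`tsum_mul_potential_le`). Summed over lines ending at a `p`-distributed vertex, this bounds the
chance of `k` ancestors by that of `k + 1` samples being distinct
(`tsum_mul_iidLaw_descentEvent_le`). Splitting the samples into two halves bounds the latter by `exp
(-x / 6)` (`distinctProb_le_exp`). The tail is thus at most `2 exp (-x / 6)`, which is stronger than
required. -/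

/-! ### Probability of sampling distinct values -/

/-- The probability that `m` independent samples from `p` are distinct and avoid `A`. -/
noncomputable def distinctProb (p : PMF ℕ+) : ℕ → Finset ℕ+ → ENNReal
  | 0, _ => 1
  | m + 1, A => ∑' i, if i ∈ A then 0 else p i * distinctProb p m (insert i A)

theorem PMF.tsum_compl_add_sum (p : PMF ℕ+) (A : Finset ℕ+) :
    (∑' i, if i ∈ A then 0 else p i) + ∑ i ∈ A, p i = 1 := by
  have h : ∑ i ∈ A, p i = ∑' i, if i ∈ A then p i else 0 := by
    rw [tsum_eq_sum (s := A) (fun i hi => by simp [hi])]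
    exact Finset.sum_congr rfl fun i hi => by simp [hi]
  rw [h, ← ENNReal.tsum_add, ← p.tsum_coe]
  exact tsum_congr fun i => by split_ifs <;> simp

theorem distinctProb_le_pow (p : PMF ℕ+) (m : ℕ) (A : Finset ℕ+) :
    distinctProb p m A ≤ (1 - ∑ i ∈ A, p i) ^ m := by
  induction m generalizing A with
  | zero => simp [distinctProb]
  | succ m ih =>
    have hA : (∑' i, if i ∈ A then 0 else p i) ≤ 1 - ∑ i ∈ A, p i := by
      refine ENNReal.le_sub_of_add_le_right ?_ (p.tsum_compl_add_sum A).le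
      exact ((le_add_self.trans_eq (p.tsum_compl_add_sum A)).trans_lt ENNReal.one_lt_top).ne
    rw [distinctProb, pow_succ']
    refine le_trans ?_ (mul_le_mul_left hA _)
    rw [← ENNReal.tsum_mul_right]
    refine ENNReal.tsum_le_tsum fun i => ?_
    split_ifs with hi
    · simp
    · refine mul_le_mul_right ((ih _).trans ?_) _
      gcongr
      exact Finset.subset_insert i A

/-- The last `h` samples must miss `A` and the first `r` samples. The exponential bound for this
factorises over the first `r`, whose own distinctness can then be dropped. -/
theorem distinctProb_add_le (p : PMF ℕ+) (h r : ℕ) (A : Finset ℕ+) :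
    distinctProb p (h + r) A ≤
      (∑' i, p i * ENNReal.ofReal (Real.exp (-(h * (p i).toReal)))) ^ r *
        ENNReal.ofReal (Real.exp (-(h * ∑ i ∈ A, (p i).toReal))) := by
  induction r generalizing A with
  | zero =>
    have hs : ∑ i ∈ A, p i = ENNReal.ofReal (∑ i ∈ A, (p i).toReal) := by
      rw [ENNReal.ofReal_sum_of_nonneg fun i _ => ENNReal.toReal_nonneg]
      exact Finset.sum_congr rfl fun i _ => (ENNReal.ofReal_toReal (p.apply_ne_top i)).symm
    have h1 : ∑ i ∈ A, (p i).toReal ≤ 1 := by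
      rw [← ENNReal.ofReal_le_one, ← hs]
      exact le_add_self.trans_eq (p.tsum_compl_add_sum A)
    refine (distinctProb_le_pow p h A).trans ?_
    rw [pow_zero, one_mul, hs, ← ENNReal.ofReal_one,
      ← ENNReal.ofReal_sub _ (Finset.sum_nonneg fun i _ => ENNReal.toReal_nonneg),
      ← ENNReal.ofReal_pow (sub_nonneg.2 h1), ← mul_neg, Real.exp_nat_mul]
    refine ENNReal.ofReal_le_ofReal (pow_le_pow_left₀ (sub_nonneg.2 h1) ?_ _)
    linarith [Real.add_one_le_exp (-∑ i ∈ A, (p i).toReal)]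
  | succ r ih =>
    rw [← add_assoc, distinctProb, pow_succ, mul_assoc, mul_left_comm, ← ENNReal.tsum_mul_right]
    refine ENNReal.tsum_le_tsum fun i => ?_
    split_ifs with hi
    · simp
    · refine (mul_le_mul_right (ih _) _).trans_eq ?_
      rw [Finset.sum_insert hi, mul_add, neg_add, Real.exp_add,
        ENNReal.ofReal_mul (Real.exp_pos _).le]
      ring

theorem PMF.summable_toReal_sq (p : PMF ℕ+) : Summable fun i => (p i).toReal ^ 2 := by
  have h1 : Summable fun i => (p i).toReal :=
    ENNReal.summable_toReal (by rw [p.tsum_coe]; exact ENNReal.one_ne_top)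
  refine Summable.of_nonneg_of_le (fun i => sq_nonneg _) (fun i => ?_) h1
  have := ENNReal.toReal_mono ENNReal.one_ne_top (p.coe_le_one i)
  rw [ENNReal.toReal_one] at this
  nlinarith [ENNReal.toReal_nonneg (a := p i)]

theorem sq_sigmaP (p : PMF ℕ+) : sigmaP p ^ 2 = ∑' i, (p i).toReal ^ 2 :=
  Real.sq_sqrt (tsum_nonneg fun _ => sq_nonneg _)

theorem toReal_le_sigmaP (p : PMF ℕ+) (i : ℕ+) : (p i).toReal ≤ sigmaP p :=
  Real.le_sqrt_of_sq_le (p.summable_toReal_sq.le_tsum i fun _ _ => sq_nonneg _)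

theorem sigmaP_pos (p : PMF ℕ+) : 0 < sigmaP p := by
  obtain ⟨i, hi⟩ := p.support_nonempty
  exact (ENNReal.toReal_pos ((p.mem_support_iff i).1 hi) (p.apply_ne_top i)).trans_le
    (toReal_le_sigmaP p i)

theorem tsum_mul_exp_le (p : PMF ℕ+) (h : ℕ) :
    ∑' i, p i * ENNReal.ofReal (Real.exp (-(h * (p i).toReal))) ≤
      ENNReal.ofReal (Real.exp (-(h * sigmaP p ^ 2 / (1 + h * sigmaP p)))) := by
  have hσ := sigmaP_pos p
  have hs : 0 < 1 + h * sigmaP p := by positivity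
  have h1 : Summable fun i => (p i).toReal :=
    ENNReal.summable_toReal (by rw [p.tsum_coe]; exact ENNReal.one_ne_top)
  have h1' : ∑' i, (p i).toReal = 1 := by
    rw [← ENNReal.tsum_toReal_eq p.apply_ne_top, p.tsum_coe, ENNReal.toReal_one]
  have h2 : Summable fun i => (p i).toReal - h / (1 + h * sigmaP p) * (p i).toReal ^ 2 :=
    h1.sub (p.summable_toReal_sq.mul_left _)
  have key : ∀ i, (p i).toReal * Real.exp (-(h * (p i).toReal)) ≤
      (p i).toReal - h / (1 + h * sigmaP p) * (p i).toReal ^ 2 := by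
    intro i
    have hp0 : 0 ≤ (p i).toReal := ENNReal.toReal_nonneg
    have hu : 0 < 1 + h * (p i).toReal := by positivity
    have hle : Real.exp (-(h * (p i).toReal)) ≤ 1 - h * (p i).toReal / (1 + h * sigmaP p) := by
      calc Real.exp (-(h * (p i).toReal)) ≤ 1 / (1 + h * (p i).toReal) := by
            rw [Real.exp_neg, ← one_div]
            exact one_div_le_one_div_of_le hu (by linarith [Real.add_one_le_exp (h * (p i).toReal)])
        _ = 1 - h * (p i).toReal / (1 + h * (p i).toReal) := by field_simp; ring
        _ ≤ _ := by
            gcongr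
            exact toReal_le_sigmaP p i
    calc _ ≤ (p i).toReal * (1 - h * (p i).toReal / (1 + h * sigmaP p)) := by gcongr
      _ = _ := by ring
  calc ∑' i, p i * ENNReal.ofReal (Real.exp (-(h * (p i).toReal)))
      ≤ ∑' i, ENNReal.ofReal ((p i).toReal - h / (1 + h * sigmaP p) * (p i).toReal ^ 2) := by
        refine ENNReal.tsum_le_tsum fun i => ?_
        refine le_trans (le_of_eq ?_) (ENNReal.ofReal_le_ofReal (key i))
        rw [ENNReal.ofReal_mul ENNReal.toReal_nonneg, ENNReal.ofReal_toReal (p.apply_ne_top i)]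
    _ = ENNReal.ofReal (1 - h / (1 + h * sigmaP p) * sigmaP p ^ 2) := by
        rw [← ENNReal.ofReal_tsum_of_nonneg (fun i => le_trans (by positivity) (key i)) h2,
          h1.tsum_sub (p.summable_toReal_sq.mul_left _), h1', tsum_mul_left, sq_sigmaP]
    _ ≤ _ := by
        refine ENNReal.ofReal_le_ofReal ?_
        refine le_trans (le_of_eq ?_) (Real.add_one_le_exp _)
        ring

theorem distinctProb_le_exp (p : PMF ℕ+) {x : ℝ} (hx : 8 ≤ x) {k : ℕ}
    (hk : x / (2 * sigmaP p) ≤ k) :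
    distinctProb p (k + 1) ∅ ≤ ENNReal.ofReal (Real.exp (-(x / 6))) := by
  have hσ := sigmaP_pos p
  -- Two nearly equal halves: with `s = h * sigmaP p`, the choice of `k` gives `s ≥ x / 4 ≥ 2`.
  set h := (k + 1) / 2 with hh
  obtain ⟨r, hr⟩ : ∃ r, k + 1 = h + r := ⟨k + 1 - h, by omega⟩
  have hhr : h ≤ r := by omega
  have hkh : (k : ℝ) ≤ 2 * h := by exact_mod_cast (by omega : k ≤ 2 * h)
  have hs : x / 4 ≤ h * sigmaP p := by
    rw [div_le_iff₀ (by positivity)] at hk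
    nlinarith
  rw [hr]
  refine (distinctProb_add_le p h r ∅).trans ?_
  rw [Finset.sum_empty, mul_zero, neg_zero, Real.exp_zero, ENNReal.ofReal_one, mul_one]
  refine (pow_le_pow_left' (tsum_mul_exp_le p h) r).trans ?_
  rw [← ENNReal.ofReal_pow (Real.exp_pos _).le, ← Real.exp_nat_mul]
  refine ENNReal.ofReal_le_ofReal (Real.exp_le_exp.2 ?_)
  rw [mul_neg, neg_le_neg_iff]
  have hr' : (h : ℝ) ≤ r := by exact_mod_cast hhr
  -- The right side is `s ^ 2 / (1 + s)`, at least `2 * s / 3` because `s ≥ 2`.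
  calc x / 6 ≤ h * (h * sigmaP p ^ 2 / (1 + h * sigmaP p)) := by
        rw [← mul_div_assoc, le_div_iff₀ (by positivity)]
        nlinarith
    _ ≤ _ := by gcongr

/-! ### Lines of descent in the birthday tree -/

/-- The first visit of the sequence `y` to `v` takes place just after a visit to `u`. -/
def IsParent (y : ℕ → ℕ+) (u v : ℕ+) : Prop :=
  ∃ j : ℕ, y j = u ∧ y (j + 1) = v ∧ ∀ i ≤ j, y (j + 1) ≠ y i

/-- First visits occur in the order of the line, since each one follows a visit to the parent. -/
theorem exists_le_eq_head_of_isChain {y : ℕ → ℕ+} {z : ℕ+} {i : ℕ} (hi : y i = z)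
    {v : ℕ+} {R : List ℕ+} (h : (v :: R).IsChain (IsParent y)) (hz : z ∈ v :: R) :
    ∃ j ≤ i, y j = v := by
  induction R generalizing v with
  | nil => exact ⟨i, le_rfl, by simpa [hi] using hz⟩
  | cons w R ih =>
    rw [List.isChain_cons_cons] at h
    rcases List.mem_cons.1 hz with rfl | hz
    · exact ⟨i, le_rfl, hi⟩
    · obtain ⟨j, hj, hw⟩ := ih h.2 hz
      obtain ⟨m, hm, hm', hne⟩ := h.1
      refine ⟨m, ?_, hm⟩
      by_contra! hlt
      exact hne j (by omega) (hm'.trans hw.symm)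

theorem nodup_of_isChain_isParent {y : ℕ → ℕ+} {L : List ℕ+} (h : L.IsChain (IsParent y)) :
    L.Nodup := by
  induction L with
  | nil => exact List.nodup_nil
  | cons u R ih =>
    cases R with
    | nil => simp
    | cons v R =>
      rw [List.isChain_cons_cons] at h
      refine List.nodup_cons.2 ⟨fun hu => ?_, ih h.2⟩
      obtain ⟨m, hm, hm', hne⟩ := h.1
      obtain ⟨j, hj, hv⟩ := exists_le_eq_head_of_isChain hm h.2 hu
      exact hne j hj (hm'.trans hv.symm)

/-- The sequences for which some line of descent ends in `L` and starts `k` generations before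
the head of `L`. -/
def descentEvent : ℕ → List ℕ+ → Set (ℕ → ℕ+)
  | 0, L => {y | L.IsChain (IsParent y)}
  | k + 1, L => ⋃ w, descentEvent k (w :: L)

theorem nodup_of_mem_descentEvent {y : ℕ → ℕ+} {k : ℕ} {L : List ℕ+}
    (h : y ∈ descentEvent k L) : L.Nodup := by
  induction k generalizing L with
  | zero => exact nodup_of_isChain_isParent h
  | succ k ih =>
    obtain ⟨w, hw⟩ := Set.mem_iUnion.1 h
    exact (ih hw).of_cons

/-- Climb from `u` to the value just before its first visit, and repeat: either the root is reached
in fewer than `k` steps or `k` ancestors are found. -/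
theorem edist_lt_or_mem_descentEvent {S : Set ℕ+} {y : ℕ → ℕ+} (hy : ∀ i, y i ∈ S) (k : ℕ)
    (u : S) (L : List ℕ+) (hL : ((u : ℕ+) :: L).IsChain (IsParent y)) (hu : ∃ n, y n = u) :
    (birthdayTree S y).edist ⟨y 0, hy 0⟩ u < k ∨ y ∈ descentEvent k (u :: L) := by
  classical
  induction k generalizing u L with
  | zero => exact Or.inr hL
  | succ k ih =>
    have hmin : ∀ i < Nat.find hu, y i ≠ u := fun i hi => Nat.find_min hu hi
    have hfind := Nat.find_spec hu
    rcases h0 : Nat.find hu with _ | n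
    · rw [h0] at hfind
      left
      have : (⟨y 0, hy 0⟩ : S) = u := Subtype.ext hfind
      rw [this, SimpleGraph.edist_self]
      exact_mod_cast k.succ_pos
    · rw [h0] at hfind hmin
      have hpar : IsParent y (y n) u :=
        ⟨n, rfl, hfind, fun i hi h => hmin i (by omega) (h.symm.trans hfind)⟩
      have hne : (⟨y n, hy n⟩ : S) ≠ u := fun h => hmin n (by omega) (congrArg Subtype.val h)
      rcases ih ⟨y n, hy n⟩ (u :: L) (List.isChain_cons_cons.2 ⟨hpar, hL⟩) ⟨n, rfl⟩ with h | h
      · left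
        have hadj : (birthdayTree S y).Adj ⟨y n, hy n⟩ u :=
          (SimpleGraph.fromRel_adj _ _ _).2 ⟨hne, Or.inl hpar⟩
        refine (SimpleGraph.edist_triangle (v := ⟨y n, hy n⟩)).trans_lt ?_
        rw [SimpleGraph.edist_eq_one_iff_adj.2 hadj, Nat.cast_add, Nat.cast_one]
        exact (ENat.add_lt_add_iff_right ENat.one_ne_top).2 h
      · exact Or.inr (Set.mem_iUnion.2 ⟨_, h⟩)

/-! ### Exploring a line of descent -/

/-- One step of the exploration of a line of descent. The list starts with the last vertex of the
line that was visited and goes on with the vertices to come; it becomes empty when one of these is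
visited too early. Here `c` is the previous value of the sequence and `z` the present one. -/
def advance : List ℕ+ → Option ℕ+ → ℕ+ → List ℕ+
  | [], _, _ => []
  | [v], _, _ => [v]
  | u :: v :: R, c, z =>
    if c = some u ∧ z = v then v :: R else if z ∈ v :: R then [] else u :: v :: R

/-- The state of the exploration after `n` steps. -/
def explore (s : List ℕ+ × Option ℕ+) (y : ℕ → ℕ+) : ℕ → List ℕ+ × Option ℕ+
  | 0 => s
  | n + 1 => (advance (explore s y n).1 (explore s y n).2 (y n), some (y n))

theorem explore_succ' (s : List ℕ+ × Option ℕ+) (y : ℕ → ℕ+) (n : ℕ) :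
    explore s y (n + 1) = explore (advance s.1 s.2 (y 0), some (y 0)) (fun i => y (i + 1)) n := by
  induction n with
  | zero => rfl
  | succ n ih => rw [explore, ih, explore]

theorem nodup_advance {L : List ℕ+} (hL : L.Nodup) (c : Option ℕ+) (z : ℕ+) :
    (advance L c z).Nodup := by
  match L with
  | [] => exact hL
  | [v] => exact hL
  | u :: v :: R =>
    rw [advance]
    split_ifs
    exacts [hL.of_cons, List.nodup_nil, hL]

theorem explore_eventually_eq_singleton {y : ℕ → ℕ+} {s : List ℕ+ × Option ℕ+} {u : ℕ+}
    {R : List ℕ+} {n : ℕ} (hn : (explore s y n).1 = u :: R)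
    (hR : (u :: R).IsChain (IsParent y)) (hlt : ∀ i < n, y i ∉ R) :
    ∃ N v, ∀ m ≥ N, (explore s y m).1 = [v] := by
  induction R generalizing u n with
  | nil =>
    refine ⟨n, u, fun m hm => ?_⟩
    induction m, hm using Nat.le_induction with
    | base => exact hn
    | succ m hm ih => rw [explore, ih, advance]
  | cons v R ih =>
    have hnd := nodup_of_isChain_isParent hR
    rw [List.isChain_cons_cons] at hR
    obtain ⟨m, hm, hv, hne⟩ := hR.1
    have hnm : n ≤ m + 1 := by
      by_contra! h
      exact hlt _ h (by simp [hv])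
    -- An earlier visit to the rest of the line would put a visit to `v` before its first one.
    have havoid : ∀ i ≤ m, y i ∉ v :: R := by
      intro i hi hmem
      obtain ⟨j, hj, hj'⟩ := exists_le_eq_head_of_isChain rfl hR.2 hmem
      exact hne j (by omega) (hv.trans hj'.symm)
    have hstay : (explore s y (m + 1)).1 = u :: v :: R := by
      have : ∀ i, n ≤ i → i ≤ m + 1 → (explore s y i).1 = u :: v :: R := by
        intro i hi
        induction i, hi using Nat.le_induction with
        | base => exact fun _ => hn
        | succ i hi ih =>
          intro him
          have hmem := havoid i (by omega)
          rw [explore, ih (by omega), advance, if_neg, if_neg hmem]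
          rintro ⟨-, h⟩
          exact hmem (by simp [h])
      exact this _ hnm le_rfl
    refine ih (u := v) (n := m + 2) ?_ hR.2 fun i hi => ?_
    · rw [explore, hstay, advance, if_pos ⟨by rw [explore, hm], hv⟩]
    · rcases Nat.lt_succ_iff_lt_or_eq.1 hi with hi | rfl
      · exact fun h => havoid i (by omega) (List.mem_cons_of_mem _ h)
      · rw [hv]
        exact (List.nodup_cons.1 hnd.of_cons).1

/-- The product of the weights of all but the last vertex of a list. -/
noncomputable def lineWeight (p : PMF ℕ+) (L : List ℕ+) : ENNReal :=
  (L.dropLast.map p).prod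

/-- The probability that the exploration of a line of descent succeeds from a given state. -/
noncomputable def potential (p : PMF ℕ+) : List ℕ+ → Option ℕ+ → ENNReal
  | [], _ => 0
  | [_], _ => 1
  | u :: v :: R, c =>
    if c = some u then lineWeight p (v :: R) * (p u + ((v :: R).map p).sum)
    else lineWeight p (u :: v :: R)

theorem lineWeight_cons_cons (p : PMF ℕ+) (u v : ℕ+) (R : List ℕ+) :
    lineWeight p (u :: v :: R) = p u * lineWeight p (v :: R) := by
  simp [lineWeight]

theorem potential_none (p : PMF ℕ+) (u : ℕ+) (R : List ℕ+) :
    potential p (u :: R) none = lineWeight p (u :: R) := by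
  cases R <;> simp [potential, lineWeight]

theorem mul_potential_some (p : PMF ℕ+) (v : ℕ+) (R : List ℕ+) :
    p v * potential p (v :: R) (some v) = lineWeight p (v :: R) * ((v :: R).map p).sum := by
  cases R with
  | nil => simp [potential, lineWeight]
  | cons w R =>
    rw [potential, if_pos rfl, lineWeight_cons_cons, ← mul_assoc]
    simp

/-- The potential is a supermartingale. Values off the line or equal to `u` contribute `p u * W` in
total, as `Q + p u + D = 1`; the value `v` adds `W * D` exactly when the previous value was `u`. -/
theorem tsum_mul_potential_le (p : PMF ℕ+) {L : List ℕ+} (hL : L.Nodup) (c : Option ℕ+) :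
    ∑' z, p z * potential p (advance L c z) (some z) ≤ potential p L c := by
  match L with
  | [] => simp [advance, potential]
  | [v] => simp [advance, potential, p.tsum_coe]
  | u :: v :: R =>
    set W := lineWeight p (v :: R) with hW
    set Q := ∑' z, if z ∈ (u :: v :: R).toFinset then 0 else p z with hQ
    set D := ((v :: R).map p).sum with hD
    have hu : u ∉ v :: R := (List.nodup_cons.1 hL).1
    have hsum : Q + (p u + D) = 1 := by
      rw [← p.tsum_compl_add_sum (u :: v :: R).toFinset, List.sum_toFinset _ hL]
      simp [hD, hQ]
    have hpt : ∀ z, p z * potential p (advance (u :: v :: R) c z) (some z) ≤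
        (if z = u then p u * (W * (p u + D)) else 0) +
          (if z ∈ (u :: v :: R).toFinset then 0 else p z) * (p u * W) +
          (if z = v then if c = some u then W * D else 0 else 0) := by
      intro z
      rw [advance]
      by_cases hz : z ∈ v :: R
      · by_cases h : c = some u ∧ z = v
        · obtain ⟨hc, rfl⟩ := h
          rw [if_pos ⟨hc, rfl⟩, mul_potential_some, if_pos rfl, if_pos hc]
          exact le_add_self
        · rw [if_neg h, if_pos hz, potential, mul_zero]
          exact zero_le
      · rw [if_neg (fun h => hz (by simp [h.2])), if_neg hz, potential]
        by_cases hzu : z = u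
        · subst hzu
          rw [if_pos rfl, if_pos rfl, add_assoc]
          exact le_self_add
        · have hmem : z ∉ (u :: v :: R).toFinset := by
            rw [List.mem_toFinset, List.mem_cons]
            tauto
          rw [if_neg (fun h => hzu (Option.some.inj h)), if_neg hzu, if_neg hmem, zero_add,
            lineWeight_cons_cons]
          exact le_self_add
    refine (ENNReal.tsum_le_tsum hpt).trans_eq ?_
    rw [ENNReal.tsum_add, ENNReal.tsum_add, tsum_ite_eq, tsum_ite_eq, ENNReal.tsum_mul_right, ← hQ,
      potential, lineWeight_cons_cons, ← hW, ← hD]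
    have h1 : p u * (W * (p u + D)) + Q * (p u * W) = p u * W := by
      calc _ = (Q + (p u + D)) * (p u * W) := by ring
        _ = _ := by rw [hsum, one_mul]
    rw [h1]
    split_ifs
    · ring
    · ring

/-! ### Independent sequences -/

/-- The law of a sequence of independent samples from `p`. -/
noncomputable abbrev iidLaw (p : PMF ℕ+) : Measure (ℕ → ℕ+) :=
  Measure.infinitePi fun _ : ℕ => p.toMeasure

/-- The sequence with the first term `z`, followed by `y`. -/
def consSeq (z : ℕ+) (y : ℕ → ℕ+) : ℕ → ℕ+
  | 0 => z
  | n + 1 => y n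

theorem measurable_consSeq : Measurable fun q : ℕ+ × (ℕ → ℕ+) => consSeq q.1 q.2 := by
  refine measurable_pi_iff.2 fun n => ?_
  cases n with
  | zero => exact measurable_fst
  | succ n => exact (measurable_pi_apply n).comp measurable_snd

theorem map_consSeq (p : PMF ℕ+) :
    (p.toMeasure.prod (iidLaw p)).map (fun q => consSeq q.1 q.2) = iidLaw p := by
  classical
  refine Measure.eq_infinitePi _ fun s t ht => ?_
  set s' : Finset ℕ := s.preimage (· + 1) (add_left_injective 1).injOn with hs'
  set t0 : Set ℕ+ := if 0 ∈ s then t 0 else Set.univ with ht0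
  have hpre : (fun q : ℕ+ × (ℕ → ℕ+) => consSeq q.1 q.2) ⁻¹' (s : Set ℕ).pi t =
      t0 ×ˢ (s' : Set ℕ).pi fun n => t (n + 1) := by
    ext ⟨z, y⟩
    simp only [Set.mem_preimage, Set.mem_pi, Set.mem_prod, Finset.mem_coe, hs',
      Finset.mem_preimage, ht0]
    refine ⟨fun h => ⟨?_, fun n hn => h (n + 1) hn⟩, fun h n hn => ?_⟩
    · split_ifs with h0
      exacts [h 0 h0, trivial]
    · cases n with
      | zero => simpa [hn, consSeq] using h.1
      | succ n => exact h.2 n hn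
  rw [Measure.map_apply measurable_consSeq
    (MeasurableSet.pi s.countable_toSet fun i _ => ht i), hpre, Measure.prod_prod,
    Measure.infinitePi_pi _ fun i _ => ht (i + 1)]
  have himg : ∏ n ∈ s', p.toMeasure (t (n + 1)) = ∏ n ∈ s.erase 0, p.toMeasure (t n) := by
    refine Finset.prod_bij (fun n _ => n + 1) ?_ ?_ ?_ ?_
    · intro n hn
      simpa [hs'] using hn
    · intro a _ b _ h
      exact Nat.succ_injective h
    · intro b hb
      obtain ⟨hb0, hb⟩ := Finset.mem_erase.1 hb
      obtain ⟨n, rfl⟩ := Nat.exists_eq_succ_of_ne_zero hb0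
      exact ⟨n, by simpa [hs'] using hb, rfl⟩
    · simp
  rw [himg]
  by_cases h0 : 0 ∈ s
  · rw [← Finset.mul_prod_erase s _ h0, ht0, if_pos h0]
  · rw [Finset.erase_eq_of_notMem h0, ht0, if_neg h0, measure_univ, one_mul]

theorem lintegral_iidLaw (p : PMF ℕ+) {f : (ℕ → ℕ+) → ENNReal} (hf : Measurable f) :
    ∫⁻ y, f y ∂iidLaw p = ∑' z, p z * ∫⁻ y, f (consSeq z y) ∂iidLaw p := by
  conv_lhs => rw [← map_consSeq p]
  rw [lintegral_map hf measurable_consSeq,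
    lintegral_prod (fun q : ℕ+ × (ℕ → ℕ+) => f (consSeq q.1 q.2))
      (hf.comp measurable_consSeq).aemeasurable, lintegral_countable']
  exact tsum_congr fun z => by
    rw [PMF.toMeasure_apply_singleton _ _ (MeasurableSet.singleton z), mul_comm]

theorem measurable_comp_explore (g : List ℕ+ × Option ℕ+ → ENNReal) (s : List ℕ+ × Option ℕ+)
    (n : ℕ) : Measurable fun y => g (explore s y n) := by
  let _ : MeasurableSpace (List ℕ+ × Option ℕ+) := ⊤
  have : DiscreteMeasurableSpace (List ℕ+ × Option ℕ+) := ⟨fun _ => trivial⟩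
  suffices h : Measurable fun y => explore s y n from Measurable.of_discrete.comp h
  induction n with
  | zero => exact measurable_const
  | succ n ih =>
    exact (Measurable.of_discrete (f := fun q : (List ℕ+ × Option ℕ+) × ℕ+ =>
      (advance q.1.1 q.1.2 q.2, some q.2))).comp (ih.prodMk (measurable_pi_apply n))

theorem lintegral_potential_explore_le (p : PMF ℕ+) (n : ℕ) {L : List ℕ+} (hL : L.Nodup)
    (c : Option ℕ+) :
    ∫⁻ y, potential p (explore (L, c) y n).1 (explore (L, c) y n).2 ∂iidLaw p ≤
      potential p L c := by
  induction n generalizing L c with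
  | zero => simp [explore]
  | succ n ih =>
    rw [lintegral_iidLaw p (measurable_comp_explore (fun s => potential p s.1 s.2) (L, c) (n + 1))]
    refine le_trans (ENNReal.tsum_le_tsum fun z => ?_) (tsum_mul_potential_le p hL c)
    refine mul_le_mul_right ?_ _
    simp_rw [explore_succ']
    exact ih (nodup_advance hL c z) (some z)

/-- On a line of descent the exploration ends in a singleton, of potential `1`, while its initial
potential is the line weight. Markov's inequality applies at each time `N`; the random completion
time is handled by an increasing union. -/
theorem iidLaw_isChain_le (p : PMF ℕ+) {u : ℕ+} {R : List ℕ+} (hL : (u :: R).Nodup) :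
    iidLaw p {y | (u :: R).IsChain (IsParent y)} ≤ lineWeight p (u :: R) := by
  set s : List ℕ+ × Option ℕ+ := (u :: R, none) with hs
  set E : ℕ → Set (ℕ → ℕ+) := fun N => {y | ∀ m ≥ N, ∃ v, (explore s y m).1 = [v]} with hE
  have hmono : Monotone E := fun N N' h y hy m hm => hy m (h.trans hm)
  have hsub : {y | (u :: R).IsChain (IsParent y)} ⊆ ⋃ N, E N := by
    intro y hy
    obtain ⟨N, v, hv⟩ := explore_eventually_eq_singleton (s := s) (n := 0) rfl hy (by simp)
    exact Set.mem_iUnion.2 ⟨N, fun m hm => ⟨v, hv m hm⟩⟩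
  refine (measure_mono hsub).trans ?_
  rw [hmono.measure_iUnion]
  refine iSup_le fun N => ?_
  rw [← potential_none]
  refine le_trans ?_ (lintegral_potential_explore_le p N hL none)
  refine le_trans (measure_mono fun y hy => ?_) (le_trans (one_mul _).ge (mul_meas_ge_le_lintegral
    (measurable_comp_explore (fun s => potential p s.1 s.2) s N) 1))
  obtain ⟨v, hv⟩ := hy N le_rfl
  simp [hv, potential]

/-- A union bound over the next ancestor reproduces the recursion of `distinctProb`, since lines
with a repeated vertex are impossible. -/
theorem iidLaw_descentEvent_le (p : PMF ℕ+) (k : ℕ) (u : ℕ+) (R : List ℕ+) :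
    iidLaw p (descentEvent k (u :: R)) ≤
      distinctProb p k (u :: R).toFinset * lineWeight p (u :: R) := by
  induction k generalizing u R with
  | zero =>
    rw [distinctProb, one_mul]
    by_cases hL : (u :: R).Nodup
    · exact iidLaw_isChain_le p hL
    · have : descentEvent 0 (u :: R) = ∅ :=
        Set.eq_empty_of_forall_notMem fun y hy => hL (nodup_of_mem_descentEvent hy)
      simp [this]
  | succ k ih =>
    rw [descentEvent, distinctProb, ← ENNReal.tsum_mul_right]
    refine (measure_iUnion_le _).trans (ENNReal.tsum_le_tsum fun w => ?_)
    split_ifs with hw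
    · have : descentEvent k (w :: u :: R) = ∅ :=
        Set.eq_empty_of_forall_notMem fun y hy =>
          (List.nodup_cons.1 (nodup_of_mem_descentEvent hy)).1 (List.mem_toFinset.1 hw)
      simp [this]
    · refine (ih w (u :: R)).trans_eq ?_
      rw [lineWeight_cons_cons, List.toFinset_cons (a := w)]
      ring

/-- The random end vertex supplies the one weight missing from the line weight, hence `k + 1`
samples. -/
theorem tsum_mul_iidLaw_descentEvent_le (p : PMF ℕ+) (k : ℕ) :
    ∑' v, p v * iidLaw p (descentEvent k [v]) ≤ distinctProb p (k + 1) ∅ := by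
  rw [distinctProb]
  refine ENNReal.tsum_le_tsum fun v => ?_
  rw [if_neg (Finset.notMem_empty v)]
  refine mul_le_mul_right ((iidLaw_descentEvent_le p k v []).trans_eq ?_) _
  simp [lineWeight]

theorem iidLaw_ae_mem_support (p : PMF ℕ+) : ∀ᵐ y ∂iidLaw p, ∀ i, y i ∈ p.support := by
  refine ae_all_iff.2 fun i => ?_
  have h : ∀ᵐ z ∂p.toMeasure, z ∈ p.support := by
    rw [ae_iff]
    exact (p.toMeasure_apply_eq_zero_iff MeasurableSet.of_discrete).2 (by
      rw [Set.disjoint_left]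
      exact fun z hz h => h hz)
  rw [← Measure.infinitePi_map_eval (fun _ : ℕ => p.toMeasure) i] at h
  exact ae_of_ae_map (measurable_pi_apply i).aemeasurable h

theorem iidLaw_ae_exists_eq (p : PMF ℕ+) {v : ℕ+} (hv : v ∈ p.support) :
    ∀ᵐ y ∂iidLaw p, ∃ n, y n = v := by
  have hlt : p.toMeasure {v}ᶜ < 1 := by
    rw [prob_compl_eq_one_sub (MeasurableSet.singleton v),
      PMF.toMeasure_apply_singleton _ _ (MeasurableSet.singleton v)]
    exact ENNReal.sub_lt_self ENNReal.one_ne_top one_ne_zero ((p.mem_support_iff v).1 hv)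
  rw [ae_iff]
  refine le_antisymm (ge_of_tendsto' (ENNReal.tendsto_pow_atTop_nhds_zero_of_lt_one hlt)
    fun n => ?_) zero_le
  calc iidLaw p {y | ¬∃ n, y n = v}
      ≤ iidLaw p ((Finset.range n : Set ℕ).pi fun _ => {v}ᶜ) :=
        measure_mono fun y hy i _ h => hy ⟨i, h⟩
    _ = p.toMeasure {v}ᶜ ^ n := by
        rw [Measure.infinitePi_pi _ fun _ _ => MeasurableSet.of_discrete, Finset.prod_const,
          Finset.card_range]

/-! ### Distances in a random graph -/

theorem measurableSet_exists_walk_length {V : Type*} [Countable V] (n : ℕ) (a b : V) :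
    MeasurableSet {G : SimpleGraph V | ∃ w : G.Walk a b, w.length = n} := by
  induction n generalizing a with
  | zero =>
    have : {G : SimpleGraph V | ∃ w : G.Walk a b, w.length = 0} = {_G | a = b} := by
      ext G
      refine ⟨fun ⟨w, hw⟩ => SimpleGraph.Walk.eq_of_length_eq_zero hw, ?_⟩
      rintro rfl
      exact ⟨.nil, rfl⟩
    rw [this]
    exact MeasurableSet.const _
  | succ n ih =>
    have : {G : SimpleGraph V | ∃ w : G.Walk a b, w.length = n + 1} =
        ⋃ c, {G | G.Adj a c} ∩ {G | ∃ w : G.Walk c b, w.length = n} := by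
      ext G
      simp only [Set.mem_iUnion, Set.mem_inter_iff]
      constructor
      · rintro ⟨w, hw⟩
        cases w with
        | nil => simp at hw
        | cons h w => exact ⟨_, h, w, by simpa using hw⟩
      · rintro ⟨c, h, w, hw⟩
        exact ⟨.cons h w, by simp [hw]⟩
    rw [this]
    refine MeasurableSet.iUnion fun c => MeasurableSet.inter ?_ (ih c)
    exact measurableSet_setOfPred.2 (SimpleGraph.measurable_iff_adj.1 measurable_id a c)

theorem measurableSet_le_edist {V : Type*} [Countable V] (r : ENNReal) (a b : V) :
    MeasurableSet {G : SimpleGraph V | r ≤ (G.edist a b : ENNReal)} := by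
  have : {G : SimpleGraph V | r ≤ (G.edist a b : ENNReal)} =
      ⋂ n : ℕ, {G | (∃ w : G.Walk a b, w.length = n) → r ≤ n} := by
    ext G
    simp only [Set.mem_iInter]
    constructor
    · rintro h n ⟨w, rfl⟩
      exact h.trans (by exact_mod_cast SimpleGraph.edist_le w)
    · intro h
      by_cases ht : G.edist a b = ⊤
      · change r ≤ (G.edist a b : ENNReal)
        simp [ht]
      · obtain ⟨w, hw⟩ := SimpleGraph.exists_walk_of_edist_ne_top ht
        have := h _ ⟨w, rfl⟩
        change r ≤ (G.edist a b : ENNReal)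
        rw [← hw]
        exact_mod_cast this
  rw [this]
  refine MeasurableSet.iInter fun n => ?_
  simp only [imp_iff_not_or]
  exact (measurableSet_exists_walk_length n a b).compl.union (MeasurableSet.const _)

/-! ### The tail of the distance -/

theorem pTreeLaw_le_edist_le (p : PMF ℕ+) {r : ℝ} {k : ℕ} (hk : (k : ℝ) < r / 2 + 1)
    (a b : p.support) :
    pTreeLaw p {G | ENNReal.ofReal r ≤ (G.edist a b : ENNReal)} ≤
      iidLaw p (descentEvent k [(a : ℕ+)]) + iidLaw p (descentEvent k [(b : ℕ+)]) := by
  rw [pTreeLaw, Measure.map_apply (measurable_birthdayTree _) (measurableSet_le_edist _ a b)]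
  refine le_trans (measure_mono_ae ?_) (measure_union_le _ _)
  filter_upwards [iidLaw_ae_mem_support p, iidLaw_ae_exists_eq p a.2, iidLaw_ae_exists_eq p b.2]
    with y hy ha hb hG
  have hG : ENNReal.ofReal r ≤ ((birthdayTree p.support y).edist a b : ENNReal) := hG
  rcases edist_lt_or_mem_descentEvent hy k a [] (List.isChain_singleton _) ha with ha | ha
  swap
  · exact Or.inl ha
  rcases edist_lt_or_mem_descentEvent hy k b [] (List.isChain_singleton _) hb with hb | hb
  swap
  · exact Or.inr hb
  exfalso
  obtain ⟨m, hm⟩ := ENat.ne_top_iff_exists.1 ha.ne_top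
  obtain ⟨n, hn⟩ := ENat.ne_top_iff_exists.1 hb.ne_top
  rw [← hm, Nat.cast_lt] at ha
  rw [← hn, Nat.cast_lt] at hb
  have hmn : (birthdayTree p.support y).edist a b ≤ ((m + n : ℕ) : ℕ∞) := by
    rw [Nat.cast_add, hm, hn, SimpleGraph.edist_comm (u := ⟨y 0, hy 0⟩) (v := a)]
    exact SimpleGraph.edist_triangle
  have hmn' : ((birthdayTree p.support y).edist a b : ENNReal) ≤ ((m + n : ℕ) : ENNReal) := by
    exact_mod_cast hmn
  have hrn : r ≤ ((m + n : ℕ) : ℝ) := by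
    rw [← ENNReal.ofReal_le_ofReal_iff (Nat.cast_nonneg _), ENNReal.ofReal_natCast]
    exact hG.trans hmn'
  -- Both depths are at most `k - 1`, so `k < r / 2 + 1` suffices; this leaves room for a ceiling.
  have hmk : ((m + n : ℕ) : ℝ) + 2 ≤ 2 * k := by exact_mod_cast (by omega : m + n + 2 ≤ 2 * k)
  linarith

/-- Independence allows the endpoints to be fixed before bounding the tree; each endpoint then
contributes one `distinctProb`. -/
theorem measure_le_edist_le (p : PMF ℕ+) {Ω : Type*} [MeasurableSpace Ω] (μ : Measure Ω)
    [IsProbabilityMeasure μ] (T : Ω → SimpleGraph p.support) (hT : HasLaw T (pTreeLaw p) μ)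
    (V₁ V₂ : Ω → p.support)
    (hV₁ : HasLaw (fun ω => (V₁ ω : ℕ+)) p.toMeasure μ)
    (hV₂ : HasLaw (fun ω => (V₂ ω : ℕ+)) p.toMeasure μ)
    (hV : IndepFun V₁ V₂ μ) (hVT : IndepFun (fun ω => (V₁ ω, V₂ ω)) T μ)
    {r : ℝ} {k : ℕ} (hk : (k : ℝ) < r / 2 + 1) :
    μ {ω | ENNReal.ofReal r ≤ ((T ω).edist (V₁ ω) (V₂ ω) : ENNReal)} ≤
      2 * distinctProb p (k + 1) ∅ := by
  set g : ℕ+ → ENNReal := fun v => iidLaw p (descentEvent k [v]) with hg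
  have hsing : ∀ (V : Ω → p.support), HasLaw (fun ω => (V ω : ℕ+)) p.toMeasure μ →
      ∀ a : p.support, μ (V ⁻¹' {a}) = p a := by
    intro V hV a
    rw [← PMF.toMeasure_apply_singleton p a (MeasurableSet.singleton _)]
    refine Eq.trans ?_ (hV.measure_eq (p := fun v => v ∈ ({(a : ℕ+)} : Set ℕ+))
      (MeasurableSet.singleton _))
    congr 1
    ext ω
    simp [Subtype.ext_iff]
  have hsum : ∀ f : ℕ+ → ENNReal, ∑' a : p.support, p a * f a = ∑' a, p a * f a := by
    intro f
    refine tsum_subtype_eq_of_support_subset (f := fun a => p a * f a) fun a ha => ?_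
    rw [PMF.mem_support_iff]
    exact left_ne_zero_of_mul ha
  have hone : ∑' a : p.support, p a = 1 := by simpa [p.tsum_coe] using hsum 1
  have hle : ∑' a : p.support, p a * g a ≤ distinctProb p (k + 1) ∅ :=
    (hsum g).trans_le (tsum_mul_iidLaw_descentEvent_le p k)
  have hprob : ∀ a b : p.support, μ ((fun ω => (V₁ ω, V₂ ω)) ⁻¹' {(a, b)} ∩
      T ⁻¹' {G | ENNReal.ofReal r ≤ (G.edist a b : ENNReal)}) ≤
      p a * p b * (g a + g b) := by
    intro a b
    rw [hVT.measure_inter_preimage_eq_mul _ _ MeasurableSet.of_discrete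
      (measurableSet_le_edist _ a b)]
    have h1 : (fun ω => (V₁ ω, V₂ ω)) ⁻¹' {(a, b)} = V₁ ⁻¹' {a} ∩ V₂ ⁻¹' {b} := by
      ext ω
      simp
    rw [h1, hV.measure_inter_preimage_eq_mul _ _ MeasurableSet.of_discrete
      MeasurableSet.of_discrete, hsing V₁ hV₁, hsing V₂ hV₂]
    refine mul_le_mul_right ?_ _
    exact (hT.measure_eq (p := fun G => ENNReal.ofReal r ≤ (G.edist a b : ENNReal))
      (measurableSet_le_edist _ a b)).trans_le (pTreeLaw_le_edist_le p hk a b)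
  calc μ {ω | ENNReal.ofReal r ≤ ((T ω).edist (V₁ ω) (V₂ ω) : ENNReal)}
      ≤ μ (⋃ a : p.support, ⋃ b : p.support, (fun ω => (V₁ ω, V₂ ω)) ⁻¹' {(a, b)} ∩
          T ⁻¹' {G | ENNReal.ofReal r ≤ (G.edist a b : ENNReal)}) :=
        measure_mono fun ω hω => Set.mem_iUnion₂.2 ⟨V₁ ω, V₂ ω, rfl, hω⟩
    _ ≤ ∑' a : p.support, ∑' b : p.support, p a * p b * (g a + g b) :=
        (measure_iUnion_le _).trans (ENNReal.tsum_le_tsum fun a =>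
          (measure_iUnion_le _).trans (ENNReal.tsum_le_tsum fun b => hprob a b))
    _ = ∑' a : p.support, (p a * g a * ∑' b : p.support, p b +
          p a * ∑' b : p.support, p b * g b) := by
        refine tsum_congr fun a => ?_
        rw [← ENNReal.tsum_mul_left, ← ENNReal.tsum_mul_left, ← ENNReal.tsum_add]
        exact tsum_congr fun b => by ring
    _ = 2 * ∑' a : p.support, p a * g a := by
        rw [hone, ENNReal.tsum_add, ENNReal.tsum_mul_right, ENNReal.tsum_mul_right, hone]
        ring
    _ ≤ _ := mul_le_mul_right hle _

theorem mainTheorem11 (p : PMF ℕ+) (hp : Antitone p)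
    {Ω : Type*} [MeasurableSpace Ω] (μ : Measure Ω) [IsProbabilityMeasure μ]
    (T : Ω → SimpleGraph p.support) (hT : HasLaw T (pTreeLaw p) μ)
    (V₁ V₂ : Ω → p.support)
    (hV₁ : HasLaw (fun ω => (V₁ ω : ℕ+)) p.toMeasure μ)
    (hV₂ : HasLaw (fun ω => (V₂ ω : ℕ+)) p.toMeasure μ)
    (hV : IndepFun V₁ V₂ μ)
    (hVT : IndepFun (fun ω => (V₁ ω, V₂ ω)) T μ)
    (x : ℝ) (hx : 8 ≤ x) :
    μ.real {ω | ENNReal.ofReal (x / sigmaP p) ≤ ((T ω).edist (V₁ ω) (V₂ ω) : ENNReal)} ≤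
      Real.exp (-(x ^ (1 / 3 : ℝ) / (3 * sigmaP p))) +
        6 * Real.exp (-(x ^ (2 / 3 : ℝ) / 6)) := by
  have hσ := sigmaP_pos p
  have hk : x / sigmaP p / 2 = x / (2 * sigmaP p) := by ring
  -- Here `k` is the ceiling of `x / (2 * sigmaP p)`.
  have h := (measure_le_edist_le p μ T hT V₁ V₂ hV₁ hV₂ hV hVT
    (Nat.ceil_lt_add_one (by positivity : 0 ≤ x / sigmaP p / 2))).trans
    (mul_le_mul_right (distinctProb_le_exp p hx (hk ▸ Nat.le_ceil _)) 2)
  have h' : μ.real {ω | ENNReal.ofReal (x / sigmaP p) ≤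
      ((T ω).edist (V₁ ω) (V₂ ω) : ENNReal)} ≤ 2 * Real.exp (-(x / 6)) := by
    refine ENNReal.toReal_le_of_le_ofReal (by positivity) (h.trans_eq ?_)
    rw [ENNReal.ofReal_mul zero_le_two, ENNReal.ofReal_ofNat]
  have hpow : x ^ (2 / 3 : ℝ) ≤ x := by
    simpa using Real.rpow_le_rpow_of_exponent_le (by linarith : 1 ≤ x)
      (by norm_num : (2 / 3 : ℝ) ≤ 1)
  have hexp : Real.exp (-(x / 6)) ≤ Real.exp (-(x ^ (2 / 3 : ℝ) / 6)) :=
    Real.exp_le_exp.2 (by linarith)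
  have := Real.exp_pos (-(x ^ (1 / 3 : ℝ) / (3 * sigmaP p)))
  have := Real.exp_pos (-(x / 6))
  linarith
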